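/- An \emph{arithmetic scheme} is a scheme that is separated and of finite type over $\operatorname{Spec}\mathbb{Z}$. A \emph{smooth curve} over a finite field $\mathbb{F}_q$ is an integral scheme of Krull dimension $1$ that is smooth, separated and of finite type over $\mathbb{F}_q$. Let $\mathcal{P}$ be a property, invariant under isomorphism, of arithmetic schemes of Krull dimension $\le 1$. Suppose that for all arithmetic schemes $X$ of Krull dimension $\le 1$: (a) $\mathcal{P}(X)$ holds if and only if $\mathcal{P}(X_{\mathrm{red}})$ holds; (b) if $X = \coprod_i X_i$ is a finite disjoint union of schemes, then $\mathcal{P}(X)$ holds if and only if $\mathcal{P}(X_i)$ holds for all $i$; (c) if $U \subset X$ is a dense open subscheme, then $\mathcal{P}(X)$ holds if and only if $\mathcal{P}(U)$ holds. Suppose moreover that: (0) $\mathcal{P}(\operatorname{Spec}\mathbb{F}_q)$ holds for every finite field $\mathbb{F}_q$; (1) $\mathcal{P}(C)$ holds for every smooth curve $C$ over every finite field $\mathbb{F}_q$; (2) $\mathcal{P}(\operatorname{Spec}\mathcal{O}_F)$ holds for every number field $F/\mathbb{Q}$, where $\mathcal{O}_F$ is its ring of integers. Then $\mathcal{P}(X)$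 holds for every arithmetic scheme $X$ of Krull dimension $1$. -/

import Mathlib

open CategoryTheory CategoryTheory.Limits AlgebraicGeometry
open scoped NumberField

universe u

/-- An arithmetic scheme: a scheme which is separated and of finite type over `Spec ℤ`
(locally of finite type and quasi-compact). The structure morphism is the unique one;
`ULift ℤ` is the copy of `ℤ` in the universe of the scheme. -/
structure IsArithmeticScheme (X : Scheme.{u}) : Prop where
  isSeparated : IsSeparated (specULiftZIsTerminal.{u}.from X)
  locallyOfFiniteType : LocallyOfFiniteType (specULiftZIsTerminal.{u}.from X)
  quasiCompact : QuasiCompact (specULiftZIsTerminal.{u}.from X)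

/-- An arithmetic scheme whose Krull dimension is at most one. -/
structure IsArithmeticSchemeDimLEOne (X : Scheme.{u}) : Prop extends IsArithmeticScheme X where
  krullDim_le_one : topologicalKrullDim X ≤ 1

/-- The reduction `X_red` of a scheme `X`: the closed subscheme cut out by the nilradical. -/
noncomputable def schemeReduction (X : Scheme.{u}) : Scheme.{u} :=
  X.nilradical.subscheme

/-- `f : C ⟶ Spec k` exhibits `C` as a smooth curve over the field `k`: an integral scheme of
Krull dimension one, smooth, separated and of finite type over `k`. -/
structure IsSmoothCurveOver {k : Type u} [Field k] {C : Scheme.{u}}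
    (f : C ⟶ Spec (CommRingCat.of k)) : Prop where
  isIntegral : IsIntegral C
  krullDim_eq_one : topologicalKrullDim C = 1
  smooth : Smooth f
  isSeparated : IsSeparated f
  locallyOfFiniteType : LocallyOfFiniteType f
  quasiCompact : QuasiCompact f

/-! Condition (a) allows `X` to be reduced. A reduced Noetherian scheme has a dense open subscheme
that is a finite disjoint union of integral affines (`exists_disjoint_affineOpens`), so (c) and (b)
reduce the claim to `Spec A` with `A` a domain of finite type over ℤ and of dimension at most one
(`property_Spec_of_isDomain`).

In characteristic `p`, generic smoothness over the perfect field `𝔽_p` makes some `A[1/a]` either a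
finite field or the ring of a smooth affine curve. In characteristic zero, `A ⊗ ℚ` is a number field
`F`, and `A` and `𝓞 F` become equal inside `F` after inverting one nonzero integer
(`exists_isLocalization_away_ringOfIntegers`); (c) then carries the property from `𝓞 F` to `A`. -/

theorem Int.isJacobsonRing : IsJacobsonRing ℤ := by
  rw [isJacobsonRing_iff_prime_eq]
  intro I hI
  by_cases h : I = ⊥
  · subst h
    refine le_antisymm (fun x hx ↦ ?_) Ideal.le_jacobson
    obtain ⟨p, hxp, hp⟩ := Nat.exists_infinite_primes (x.natAbs + 1)
    have hmax : (Ideal.span {(p : ℤ)}).IsMaximal :=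
      PrincipalIdealRing.isMaximal_of_irreducible (Nat.prime_iff_prime_int.mp hp).irreducible
    have hmem := (Ideal.mem_sInf.mp hx) (I := Ideal.span {(p : ℤ)}) ⟨bot_le, hmax⟩
    rw [Ideal.mem_span_singleton] at hmem
    exact Int.eq_zero_of_dvd_of_natAbs_lt_natAbs hmem (by simpa using hxp)
  · have := hI.isMaximal h
    exact Ideal.jacobson_eq_self_of_isMaximal

/-- Zariski's lemma over the Jacobson ring ℤ would make such a field integral over ℤ, forcing ℤ to
be a field. -/
theorem CharZero.not_isField_of_finiteType_int (K : Type*) [CommRing K] [Algebra.FiniteType ℤ K]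
    (hK : Function.Injective (algebraMap ℤ K)) : ¬ IsField K := by
  intro h
  let _ : Field K := h.toField
  have := Int.isJacobsonRing
  have : Module.Finite ℤ K := finite_of_finite_type_of_isJacobsonRing ℤ K
  exact Int.not_isField (isField_of_isIntegral_of_isField hK h)

theorem Field.finite_of_finiteType_int (K : Type*) [Field K] [Algebra.FiniteType ℤ K] :
    Finite K := by
  obtain ⟨p, hp⟩ := CharP.exists K
  rcases CharP.char_is_prime_or_zero K p with hpp | rfl
  · have : Fact p.Prime := ⟨hpp⟩
    let _ : Algebra (ZMod p) K := ZMod.algebra K p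
    have : Algebra.FiniteType (ZMod p) K := .of_restrictScalars_finiteType ℤ _ _
    have : Module.Finite (ZMod p) K := finite_of_finite_type_of_isJacobsonRing _ K
    exact Module.finite_of_finite (ZMod p)
  · have : CharZero K := CharP.charP_to_charZero K
    exact absurd (Field.toIsField K)
      (CharZero.not_isField_of_finiteType_int K (algebraMap ℤ K).injective_int)

/-! ### The generic fibre over ℤ -/

/-- A nonzero prime of `B` would contract to a maximal ideal of `A`. Nonzero integers are units in
`B`, so the residue field in `A` would have characteristic zero while being of finite type over ℤ.
-/
theorem IsLocalization.isField_of_krullDimLE_one (A B : Type*) [CommRing A] [IsDomain A]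
    [CharZero A] [Algebra.FiniteType ℤ A] [Ring.KrullDimLE 1 A] [CommRing B] [IsDomain B]
    [Algebra A B] [IsLocalization (Algebra.algebraMapSubmonoid A (nonZeroDivisors ℤ)) B]
    (hAB : Function.Injective (algebraMap A B)) : IsField B := by
  by_contra hB
  obtain ⟨I, hI0, hI⟩ := Ring.not_isField_iff_exists_prime.mp hB
  have hne : I.under A ≠ ⊥ := fun h ↦ hI0 <| by
    rw [← IsLocalization.map_under (Algebra.algebraMapSubmonoid A (nonZeroDivisors ℤ)) B I]
    exact (Ideal.map_eq_bot_iff_of_injective hAB).mpr h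
  have hmax : (I.under A).IsMaximal := Ideal.isMaximal_of_isPrime_of_ne_bot _ hne
  have hfield : IsField (A ⧸ I.under A) :=
    (Ideal.Quotient.maximal_ideal_iff_isField_quotient _).mp hmax
  have := Algebra.FiniteType.of_surjective (Ideal.Quotient.mk (I.under A)).toIntAlgHom
    Ideal.Quotient.mk_surjective
  refine CharZero.not_isField_of_finiteType_int _ ?_ hfield
  rw [injective_iff_map_eq_zero]
  intro n hn
  by_contra hn0
  rw [eq_intCast, ← map_intCast (Ideal.Quotient.mk (I.under A)),
    Ideal.Quotient.eq_zero_iff_mem, Ideal.mem_comap] at hn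
  refine hI.ne_top (Ideal.eq_top_of_isUnit_mem _ hn ?_)
  exact IsLocalization.map_units B (⟨(n : A), n, mem_nonZeroDivisors_of_ne_zero hn0, by simp⟩ :
    Algebra.algebraMapSubmonoid A (nonZeroDivisors ℤ))

/-- As a quotient of `ℚ ⊗ A`, the field `B` is of finite type over ℚ, hence finite by Zariski's
lemma. -/
theorem NumberField.of_isLocalization_int (A B : Type*) [CommRing A] [CharZero A]
    [Algebra.FiniteType ℤ A] [Field B] [Algebra A B]
    [IsLocalization (Algebra.algebraMapSubmonoid A (nonZeroDivisors ℤ)) B]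
    (hAB : Function.Injective (algebraMap A B)) : NumberField B := by
  have : CharZero B := charZero_of_injective_algebraMap hAB
  let f : TensorProduct ℤ ℚ A →ₐ[ℚ] B :=
    Algebra.TensorProduct.lift (Algebra.ofId ℚ B) (algebraMap A B).toIntAlgHom
      fun _ _ ↦ Commute.all _ _
  have hf : Function.Surjective f := fun b ↦ by
    obtain ⟨a, ⟨_, ⟨n, hn, rfl⟩⟩, rfl⟩ := IsLocalization.exists_mk'_eq
      (Algebra.algebraMapSubmonoid A (nonZeroDivisors ℤ)) b
    have hn0 : n ≠ 0 := nonZeroDivisors.ne_zero hn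
    refine ⟨(n : ℚ)⁻¹ ⊗ₜ a, ?_⟩
    rw [IsLocalization.eq_mk'_iff_mul_eq]
    have : (n : B) ≠ 0 := by exact_mod_cast hn0
    simp [f]
    field_simp
  have : Algebra.FiniteType ℚ B := .of_surjective f hf
  have : Module.Finite ℚ B := finite_of_finite_type_of_isJacobsonRing ℚ B
  exact ⟨⟩

/-! ### Comparing orders after inverting an integer -/

/-- The `ℤ`-subalgebra of elements of `K` that some power of `n` multiplies into `S`. -/
def Subalgebra.awayInt {K : Type*} [CommRing K] (S : Subalgebra ℤ K) (n : ℤ) :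
    Subalgebra ℤ K where
  carrier := {x | ∃ k : ℕ, (n : K) ^ k * x ∈ S}
  mul_mem' := by
    rintro a b ⟨k, hk⟩ ⟨l, hl⟩
    exact ⟨k + l, by convert mul_mem hk hl using 1; ring⟩
  add_mem' := by
    rintro a b ⟨k, hk⟩ ⟨l, hl⟩
    refine ⟨k + l, ?_⟩
    convert add_mem (mul_mem (pow_mem (intCast_mem S n) l) hk) (mul_mem (pow_mem (intCast_mem S n) k) hl) using 1
    ring
  algebraMap_mem' r := ⟨0, by simp⟩

theorem Subalgebra.exists_le_awayInt {K : Type*} [Field K] [Algebra.IsAlgebraic ℤ K]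
    (S : Subalgebra ℤ K) (hS : S.FG) : ∃ n : ℤ, n ≠ 0 ∧
      S ≤ (integralClosure ℤ K).awayInt n := by
  obtain ⟨s, rfl⟩ := hS
  obtain ⟨n, hn, h⟩ := Algebra.IsAlgebraic.exists_integral_multiples ℤ s
  refine ⟨n, hn, Algebra.adjoin_le fun x hx ↦ ⟨1, ?_⟩⟩
  simpa [mem_integralClosure_iff] using h x hx

theorem Subalgebra.exists_integralClosure_le_awayInt {K : Type*} [Field K] [NumberField K]
    (S : Subalgebra ℤ K) (hS : ∀ x : K, ∃ n : ℤ, n ≠ 0 ∧ (n : K) * x ∈ S) : ∃ n : ℤ, n ≠ 0 ∧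
      integralClosure ℤ K ≤ S.awayInt n := by
  classical
  have hfg : (integralClosure ℤ K).FG := by
    have : Module.Finite ℤ (𝓞 K) := inferInstance
    rw [Subalgebra.fg_iff_finiteType]
    exact (inferInstance : Algebra.FiniteType ℤ (𝓞 K))
  obtain ⟨s, hs⟩ := hfg
  choose m hm hmS using hS
  refine ⟨∏ x ∈ s, m x, Finset.prod_ne_zero_iff.mpr fun x _ ↦ hm x, ?_⟩
  rw [← hs]
  refine Algebra.adjoin_le fun x hx ↦ ⟨1, ?_⟩
  rw [← Finset.prod_erase_mul _ _ hx, pow_one, Int.cast_mul, mul_assoc]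
  exact mul_mem (intCast_mem _ _) (hmS x)

theorem Subalgebra.awayInt_mono {K : Type*} [CommRing K] {S T : Subalgebra ℤ K} {n m : ℤ}
    (hnm : n ∣ m) (h : S ≤ T) : S.awayInt n ≤ T.awayInt m := by
  rintro x ⟨k, hk⟩
  obtain ⟨l, rfl⟩ := hnm
  refine ⟨k, ?_⟩
  rw [Int.cast_mul, mul_pow, mul_comm _ ((l : K) ^ k), mul_assoc]
  exact mul_mem (pow_mem (intCast_mem _ _) _) (h hk)

theorem Subalgebra.le_awayInt {K : Type*} [CommRing K] (S : Subalgebra ℤ K) (n : ℤ) :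
    S ≤ S.awayInt n :=
  fun _ hx ↦ ⟨0, by simpa using hx⟩

theorem Subalgebra.awayInt_le_of_le {K : Type*} [CommRing K] {S T : Subalgebra ℤ K} {n : ℤ}
    (h : S ≤ T.awayInt n) :
    S.awayInt n ≤ T.awayInt n := by
  rintro x ⟨k, hk⟩
  obtain ⟨l, hl⟩ := h hk
  exact ⟨l + k, by rwa [pow_add, mul_assoc]⟩

/-- Keeping `T` and `R` separate from `S` lets one and the same ring serve as a localization of both
`A` and `𝓞 K`. -/
theorem Subalgebra.isLocalization_awayInt {K : Type*} [Field K] [CharZero K] (S : Subalgebra ℤ K)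
    {n : ℤ} (hn : n ≠ 0) {T : Subalgebra ℤ K} (hT : T = S.awayInt n)
    {R : Type*} [CommRing R] [Algebra R T]
    (e : R ≃+* S) (he : ∀ r, (algebraMap R T r : K) = e r) :
    IsLocalization.Away (n : R) T := by
  subst hT
  have hn' : (n : K) ≠ 0 := by exact_mod_cast hn
  refine .mk _ ?_ ?_ ?_
  · rw [map_intCast]
    refine IsUnit.of_mul_eq_one ⟨(n : K)⁻¹, 1, by simp [hn', one_mem]⟩ (Subtype.ext ?_)
    simp [hn']
  · rintro ⟨x, k, hk⟩
    refine ⟨k, e.symm ⟨_, hk⟩, Subtype.ext ?_⟩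
    simp [he, mul_comm]
  · intro a b hab
    refine ⟨0, ?_⟩
    have := congrArg Subtype.val hab
    rw [he, he] at this
    simpa using e.injective (Subtype.ext this)

theorem exists_isLocalization_away_ringOfIntegers_of_isLocalization (A K : Type u) [CommRing A]
    [Algebra.FiniteType ℤ A] [Field K] [NumberField K] [Algebra A K]
    [IsLocalization (Algebra.algebraMapSubmonoid A (nonZeroDivisors ℤ)) K]
    (hinj : Function.Injective (algebraMap A K)) :
    ∃ (F : Type u) (_ : Field F) (_ : NumberField F) (n : ℤ) (B : Type u) (_ : CommRing B)
      (_ : Algebra A B) (_ : Algebra (𝓞 F) B), n ≠ 0 ∧ IsLocalization.Away (n : A) B ∧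
        IsLocalization.Away (n : 𝓞 F) B := by
  have : Algebra.IsAlgebraic ℤ K :=
    (IsFractionRing.comap_isAlgebraic_iff (K := ℚ)).mpr inferInstance
  let S : Subalgebra ℤ K := (algebraMap A K).toIntAlgHom.range
  let e : A ≃+* S := (AlgEquiv.ofInjective (algebraMap A K).toIntAlgHom hinj).toRingEquiv
  have hSfg : S.FG := by
    rw [Subalgebra.fg_iff_finiteType]
    exact .of_surjective (AlgEquiv.ofInjective (algebraMap A K).toIntAlgHom hinj).toAlgHom
      (AlgEquiv.ofInjective (algebraMap A K).toIntAlgHom hinj).surjective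
  obtain ⟨n₁, hn₁, h₁⟩ := S.exists_le_awayInt hSfg
  obtain ⟨n₂, hn₂, h₂⟩ := S.exists_integralClosure_le_awayInt fun x ↦ by
    obtain ⟨a, ⟨_, n, hn, rfl⟩, rfl⟩ := IsLocalization.exists_mk'_eq
      (Algebra.algebraMapSubmonoid A (nonZeroDivisors ℤ)) x
    refine ⟨n, nonZeroDivisors.ne_zero hn, a, ?_⟩
    have := IsLocalization.mk'_spec' K a
      (⟨_, n, hn, rfl⟩ : Algebra.algebraMapSubmonoid A (nonZeroDivisors ℤ))
    simpa using this.symm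
  have hn : n₁ * n₂ ≠ 0 := mul_ne_zero hn₁ hn₂
  -- Clearing denominators of finitely many generators puts each subalgebra inside a localization of
  -- the other; the product of the two integers serves both inclusions.
  have heq : S.awayInt (n₁ * n₂) = (integralClosure ℤ K).awayInt (n₁ * n₂) :=
    le_antisymm
      (Subalgebra.awayInt_le_of_le (h₁.trans (Subalgebra.awayInt_mono (dvd_mul_right _ _) le_rfl)))
      (Subalgebra.awayInt_le_of_le (h₂.trans (Subalgebra.awayInt_mono (dvd_mul_left _ _) le_rfl)))
  let φ : A →+* S.awayInt (n₁ * n₂) :=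
    (Subalgebra.inclusion (S.le_awayInt (n₁ * n₂))).toRingHom.comp e.toRingHom
  let ψ : 𝓞 K →+* S.awayInt (n₁ * n₂) := (Subalgebra.inclusion
    (((integralClosure ℤ K).le_awayInt (n₁ * n₂)).trans heq.ge)).toRingHom
  let _ : Algebra A (S.awayInt (n₁ * n₂)) := φ.toAlgebra
  let _ : Algebra (𝓞 K) (S.awayInt (n₁ * n₂)) := ψ.toAlgebra
  refine ⟨K, _, ‹_›, n₁ * n₂, S.awayInt (n₁ * n₂), _, φ.toAlgebra, ψ.toAlgebra, hn,
    S.isLocalization_awayInt hn rfl e fun _ ↦ rfl,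
    (integralClosure ℤ K).isLocalization_awayInt hn heq (.refl (𝓞 K)) fun _ ↦ rfl⟩

/-- A domain of dimension at most one that is of finite type over `ℤ` and of characteristic zero
becomes, after inverting an integer, a localization of the ring of integers of its fraction
field, which is a number field. -/
theorem exists_isLocalization_away_ringOfIntegers (A : Type u) [CommRing A] [IsDomain A]
    [CharZero A] [Algebra.FiniteType ℤ A] [Ring.KrullDimLE 1 A] :
    ∃ (F : Type u) (_ : Field F) (_ : NumberField F) (n : ℤ) (B : Type u) (_ : CommRing B)
      (_ : Algebra A B) (_ : Algebra (𝓞 F) B), n ≠ 0 ∧ IsLocalization.Away (n : A) B ∧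
        IsLocalization.Away (n : 𝓞 F) B := by
  let M := Algebra.algebraMapSubmonoid A (nonZeroDivisors ℤ)
  have hM : M ≤ nonZeroDivisors A :=
    map_le_nonZeroDivisors_of_injective (algebraMap ℤ A) (algebraMap ℤ A).injective_int le_rfl
  let K := Localization M
  have : IsDomain K := IsLocalization.isDomain_localization hM
  have hinj : Function.Injective (algebraMap A K) := IsLocalization.injective _ hM
  let _ : Field K := (IsLocalization.isField_of_krullDimLE_one A _ hinj).toField
  have hK : NumberField K := NumberField.of_isLocalization_int A K hinj
  exact exists_isLocalization_away_ringOfIntegers_of_isLocalization A K hinj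

/-! ### Permanence properties of arithmetic schemes -/

instance : IsNoetherianRing (ULift.{u} ℤ) :=
  isNoetherianRing_of_ringEquiv ℤ ULift.ringEquiv.symm

theorem IsArithmeticScheme.of_hom {X Y : Scheme.{u}} (hX : IsArithmeticScheme X) (f : Y ⟶ X)
    [IsSeparated f] [LocallyOfFiniteType f] [QuasiCompact f] : IsArithmeticScheme Y := by
  have := hX.isSeparated
  have := hX.locallyOfFiniteType
  have := hX.quasiCompact
  have h : specULiftZIsTerminal.{u}.from Y = f ≫ specULiftZIsTerminal.{u}.from X :=
    specULiftZIsTerminal.hom_ext _ _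
  constructor <;> rw [h] <;> infer_instance

theorem IsArithmeticScheme.isNoetherian {X : Scheme.{u}} (hX : IsArithmeticScheme X) :
    IsNoetherian X := by
  have := hX.locallyOfFiniteType
  have := hX.quasiCompact
  have := LocallyOfFiniteType.isLocallyNoetherian (specULiftZIsTerminal.{u}.from X)
  have : CompactSpace X := QuasiCompact.compactSpace_of_compactSpace (specULiftZIsTerminal.{u}.from X)
  exact {}

theorem IsArithmeticSchemeDimLEOne.of_isOpenImmersion {X Y : Scheme.{u}}
    (hX : IsArithmeticSchemeDimLEOne X) (f : Y ⟶ X) [IsOpenImmersion f] :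
    IsArithmeticSchemeDimLEOne Y := by
  have := hX.isNoetherian
  have : TopologicalSpace.NoetherianSpace Y := f.isOpenEmbedding.isInducing.noetherianSpace
  exact ⟨hX.of_hom f, f.isOpenEmbedding.isInducing.topologicalKrullDim_le.trans hX.krullDim_le_one⟩

theorem isArithmeticScheme_Spec_iff (R : Type u) [CommRing R] :
    IsArithmeticScheme (Spec (.of R)) ↔ Algebra.FiniteType ℤ R := by
  let φ : ULift.{u} ℤ →+* R := (Int.castRingHom R).comp ULift.ringEquiv.toRingHom
  have h : specULiftZIsTerminal.{u}.from (Spec (.of R)) = Spec.map (CommRingCat.ofHom φ) :=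
    specULiftZIsTerminal.hom_ext _ _
  have key : LocallyOfFiniteType (Spec.map (CommRingCat.ofHom φ)) ↔ Algebra.FiniteType ℤ R := by
    rw [HasRingHomProperty.Spec_iff (P := @LocallyOfFiniteType)]
    have : φ.FiniteType ↔ (Int.castRingHom R).FiniteType :=
      ⟨fun h ↦ RingHom.FiniteType.of_comp_finiteType (f := ULift.ringEquiv.toRingHom) h,
        fun h ↦ RingHom.FiniteType.comp (g := Int.castRingHom R) h
          (.of_surjective _ ULift.ringEquiv.surjective)⟩
    exact this.trans (RingHom.finiteType_algebraMap (A := ℤ) (B := R))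
  constructor
  · intro hR
    rw [← key, ← h]
    exact hR.locallyOfFiniteType
  · intro hR
    constructor <;> rw [h]
    · infer_instance
    · exact key.mpr hR
    · infer_instance

theorem isArithmeticSchemeDimLEOne_Spec_iff (R : Type u) [CommRing R] :
    IsArithmeticSchemeDimLEOne (Spec (.of R)) ↔ Algebra.FiniteType ℤ R ∧ Ring.KrullDimLE 1 R := by
  rw [Ring.krullDimLE_iff, ← PrimeSpectrum.topologicalKrullDim_eq_ringKrullDim,
    ← isArithmeticScheme_Spec_iff]
  exact ⟨fun h ↦ ⟨h.1, h.2⟩, fun h ↦ ⟨h.1, h.2⟩⟩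

theorem CategoryTheory.ObjectProperty.iff_of_isOpenImmersion {P : ObjectProperty Scheme.{u}}
    [P.IsClosedUnderIsomorphisms]
    (h_open : ∀ X : Scheme.{u}, IsArithmeticSchemeDimLEOne X →
      ∀ U : X.Opens, Dense (U : Set X) → (P X ↔ P U.toScheme))
    {X Y : Scheme.{u}} (hX : IsArithmeticSchemeDimLEOne X) (f : Y ⟶ X) [IsOpenImmersion f]
    (hf : DenseRange f) : P X ↔ P Y := by
  rw [h_open X hX f.opensRange hf]
  exact P.prop_iff_of_iso f.isoOpensRange.symm

theorem CategoryTheory.ObjectProperty.Spec_iff_of_isLocalization_away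
    {P : ObjectProperty Scheme.{u}} [P.IsClosedUnderIsomorphisms]
    (h_open : ∀ X : Scheme.{u}, IsArithmeticSchemeDimLEOne X →
      ∀ U : X.Opens, Dense (U : Set X) → (P X ↔ P U.toScheme))
    {A B : Type u} [CommRing A] [IsDomain A] [Algebra.FiniteType ℤ A] [Ring.KrullDimLE 1 A]
    [CommRing B] [Algebra A B] {a : A} (ha : a ≠ 0) [IsLocalization.Away a B] :
    P (Spec (.of A)) ↔ P (Spec (.of B)) := by
  have := IsOpenImmersion.of_isLocalization (S := B) a
  refine iff_of_isOpenImmersion h_open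
    ((isArithmeticSchemeDimLEOne_Spec_iff A).mpr ⟨inferInstance, inferInstance⟩)
    (Spec.map (CommRingCat.ofHom (algebraMap A B))) ?_
  refine IsOpen.dense (Spec.map (CommRingCat.ofHom (algebraMap A B))).isOpenEmbedding.isOpen_range ?_
  have := IsLocalization.Away.isDomain B ha
  have : Nonempty (Spec (.of B)) := inferInstanceAs (Nonempty (PrimeSpectrum B))
  exact Set.range_nonempty _

theorem schemeReduction_isReduced (X : Scheme.{u}) :
    AlgebraicGeometry.IsReduced (schemeReduction X) := by
  have (U : X.affineOpens) : AlgebraicGeometry.IsReduced (X.nilradical.subschemeCover.openCover.X U) := by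
    change AlgebraicGeometry.IsReduced (Spec (.of (Γ(X, U) ⧸ X.nilradical.ideal U)))
    have : _root_.IsReduced (Γ(X, U) ⧸ X.nilradical.ideal U) := by
      rw [← Ideal.isRadical_iff_quotient_reduced]
      exact Ideal.radical_isRadical _
    infer_instance
  have (U : X.nilradical.subschemeCover.openCover.I₀) :
      AlgebraicGeometry.IsReduced (X.nilradical.subschemeCover.openCover.X U) := this U
  exact IsReduced.of_openCover _ X.nilradical.subschemeCover.openCover

theorem IsArithmeticSchemeDimLEOne.schemeReduction {X : Scheme.{u}}
    (hX : IsArithmeticSchemeDimLEOne X) : IsArithmeticSchemeDimLEOne (schemeReduction X) := by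
  let f : _root_.schemeReduction X ⟶ X := X.nilradical.subschemeι
  have : IsClosedImmersion f := inferInstanceAs (IsClosedImmersion X.nilradical.subschemeι)
  exact ⟨hX.of_hom f, f.isEmbedding.isInducing.topologicalKrullDim_le.trans hX.krullDim_le_one⟩

/-! ### The case of an integral affine scheme -/

/-- Over a perfect field the smooth locus is dense, so it contains a nonempty basic open `D(a)`.
Excluding fields forces the dimension to be exactly one. -/
theorem exists_isSmoothCurveOver_of_not_isField {k A : Type u} [Field k] [PerfectField k]
    [CommRing A] [IsDomain A] [Algebra k A] [Algebra.FiniteType k A] :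
    ∃ a : A, a ≠ 0 ∧ ∀ (B : Type u) [CommRing B] [Algebra A B] [IsLocalization.Away a B]
      [Ring.KrullDimLE 1 B], ¬ IsField B →
      ∃ f : Spec (.of B) ⟶ Spec (.of k), IsSmoothCurveOver f := by
  let f : Spec (.of A) ⟶ Spec (.of k) := Spec.map (CommRingCat.ofHom (algebraMap k A))
  have hft : LocallyOfFiniteType f := by
    rw [HasRingHomProperty.Spec_iff (P := @LocallyOfFiniteType)]
    exact RingHom.finiteType_algebraMap.mpr inferInstance
  have : LocallyOfFinitePresentation f := LocallyOfFinitePresentation.iff_locallyOfFiniteType.mpr hft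
  have : Nonempty (Spec (.of A)) := inferInstanceAs (Nonempty (PrimeSpectrum A))
  obtain ⟨x, hx⟩ := f.dense_smoothLocus_of_perfectField.nonempty
  obtain ⟨_, ⟨_, ⟨a, rfl⟩, rfl⟩, hxa, ha⟩ := PrimeSpectrum.isBasis_basic_opens.exists_subset_of_mem_open
    hx f.smoothLocus.isOpen
  have ha0 : a ≠ 0 := by
    rintro rfl
    exact hxa (zero_mem _)
  refine ⟨a, ha0, fun B _ _ _ _ hB ↦ ?_⟩
  let g : Spec (.of B) ⟶ Spec (.of A) := Spec.map (CommRingCat.ofHom (algebraMap A B))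
  have : IsOpenImmersion g := IsOpenImmersion.of_isLocalization a
  have : IsDomain B := IsLocalization.Away.isDomain B ha0
  refine ⟨g ≫ f, inferInstance, ?_, ?_, inferInstance, inferInstance, inferInstance⟩
  · refine (PrimeSpectrum.topologicalKrullDim_eq_ringKrullDim B).trans (le_antisymm ?_ ?_)
    · exact Ring.krullDimLE_iff.mp ‹_›
    · by_contra h
      have : Ring.KrullDimLE 0 B := Ring.krullDimLE_iff.mpr (ENat.WithBot.lt_add_one_iff.mp (not_le.mp h))
      exact hB Ring.KrullDimLE.isField_of_isDomain
  · rw [← Scheme.Hom.smoothLocus_eq_top_iff, ← Scheme.Hom.preimage_smoothLocus_eq, eq_top_iff]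
    intro y _
    refine ha ?_
    rw [← PrimeSpectrum.localization_away_comap_range B a]
    exact ⟨y, rfl⟩

theorem property_Spec_of_isDomain
    (P : ObjectProperty Scheme.{u}) [P.IsClosedUnderIsomorphisms]
    (h_open : ∀ X : Scheme.{u}, IsArithmeticSchemeDimLEOne X →
      ∀ U : X.Opens, Dense (U : Set X) → (P X ↔ P U.toScheme))
    (h_finite : ∀ (k : Type u) [Field k] [Finite k], P (Spec (CommRingCat.of k)))
    (h_curve : ∀ (k : Type u) [Field k] [Finite k] (C : Scheme.{u})
      (f : C ⟶ Spec (CommRingCat.of k)), IsSmoothCurveOver f → P C)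
    (h_numberField : ∀ (F : Type u) [Field F] [NumberField F],
      P (Spec (CommRingCat.of (𝓞 F))))
    (A : Type u) [CommRing A] [IsDomain A] [Algebra.FiniteType ℤ A] [Ring.KrullDimLE 1 A] :
    P (Spec (.of A)) := by
  have of_isField (K : Type u) [CommRing K] [Algebra.FiniteType ℤ K] (hK : IsField K) :
      P (Spec (.of K)) := by
    let _ := hK.toField
    have := Field.finite_of_finiteType_int K
    exact h_finite K
  obtain ⟨p, hp⟩ := CharP.exists A
  rcases CharP.char_is_prime_or_zero A p with hpp | rfl
  · have : Fact p.Prime := ⟨hpp⟩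
    let _ : Algebra (ZMod p) A := ZMod.algebra A p
    let _ : Algebra (ULift.{u} (ZMod p)) A :=
      ((algebraMap (ZMod p) A).comp ULift.ringEquiv.toRingHom).toAlgebra
    have : Algebra.FiniteType (ULift.{u} (ZMod p)) A := by
      rw [← RingHom.finiteType_algebraMap]
      refine .of_comp_finiteType (f := Int.castRingHom _) ?_
      rw [RingHom.ext_int (RingHom.comp _ _) (algebraMap ℤ A), RingHom.finiteType_algebraMap]
      infer_instance
    obtain ⟨a, ha, h⟩ := exists_isSmoothCurveOver_of_not_isField (k := ULift.{u} (ZMod p)) (A := A)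
    let B := Localization.Away a
    rw [ObjectProperty.Spec_iff_of_isLocalization_away h_open (B := B) ha]
    have hB := ((isArithmeticSchemeDimLEOne_Spec_iff A).mpr
      ⟨inferInstance, inferInstance⟩).of_isOpenImmersion
        (Spec.map (CommRingCat.ofHom (algebraMap A B)))
    obtain ⟨_, _⟩ := (isArithmeticSchemeDimLEOne_Spec_iff B).mp hB
    -- Isolated closed points of `X` land in the field case.
    by_cases hf : IsField B
    · exact of_isField B hf
    · obtain ⟨f, hf⟩ := h B hf
      exact h_curve _ _ f hf
  · have : CharZero A := CharP.charP_to_charZero A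
    obtain ⟨F, _, _, n, B, _, _, _, hn, _, _⟩ := exists_isLocalization_away_ringOfIntegers A
    have : Ring.KrullDimLE 1 (𝓞 F) := inferInstance
    have : Algebra.FiniteType ℤ (𝓞 F) := inferInstance
    have hA : (n : A) ≠ 0 := by exact_mod_cast hn
    have hO : (n : 𝓞 F) ≠ 0 := by exact_mod_cast hn
    rw [ObjectProperty.Spec_iff_of_isLocalization_away h_open (B := B) hA,
      ← ObjectProperty.Spec_iff_of_isLocalization_away h_open (B := B) hO]
    exact h_numberField F

/-- Removing from each of the finitely many irreducible components all the others leaves disjoint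
nonempty opens. An affine open chosen inside each is irreducible, and dense in its component. -/
theorem AlgebraicGeometry.Scheme.exists_disjoint_affineOpens (X : Scheme.{u}) [IsNoetherian X]
    [AlgebraicGeometry.IsReduced X] :
    ∃ (n : ℕ) (U : Fin n → X.Opens), (∀ i, IsAffineOpen (U i)) ∧ (∀ i, IsIntegral (U i)) ∧
      (Pairwise fun i j ↦ Disjoint (U i : Set X) (U j)) ∧ Dense (⋃ i, (U i : Set X)) := by
  have hfin : (irreducibleComponents X).Finite :=
    TopologicalSpace.NoetherianSpace.finite_irreducibleComponents
  have key (Z : irreducibleComponents X) : ∃ U : X.Opens, IsAffineOpen U ∧ (U : Set X).Nonempty ∧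
      U ≤ X.irreducibleComponentOpen Z := by
    have hne : (X.irreducibleComponentOpen Z : Set X).Nonempty := by
      have := closure_sUnion_irreducibleComponents_sdiff_singleton hfin Z.1 Z.2
      rw [← closure_nonempty_iff]
      exact Set.Nonempty.mono this.ge Z.2.1.1
    obtain ⟨x, hx⟩ := hne
    obtain ⟨_, ⟨U, hU, rfl⟩, hxU, hUV⟩ := X.isBasis_affineOpens.exists_subset_of_mem_open hx
      (X.irreducibleComponentOpen Z).isOpen
    exact ⟨U, hU, ⟨x, hxU⟩, hUV⟩
  choose U hUa hUne hUle using key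
  have hsub (Z : irreducibleComponents X) : (U Z : Set X) ⊆ Z := by
    have := closure_sUnion_irreducibleComponents_sdiff_singleton hfin Z.1 Z.2
    exact Set.Subset.trans (SetLike.coe_subset_coe.mpr (hUle Z)) (subset_closure.trans this.le)
  have : Finite (irreducibleComponents X) := hfin
  let e := (Finite.equivFin (irreducibleComponents X)).symm
  refine ⟨_, fun i ↦ U (e i), fun i ↦ hUa _, fun i ↦ ?_, fun i j hij ↦ ?_, ?_⟩
  · have : IrreducibleSpace (U (e i)) := by
      have := (e i).2.1.2.open_subset (U (e i)).isOpen (hsub _)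
      exact isIrreducible_iff_irreducibleSpace.mp ⟨hUne _, this⟩
    exact isIntegral_of_irreducibleSpace_of_isReduced _
  · refine Set.disjoint_left.mpr fun x hi hj ↦ hUle (e i) hi ⟨e j, ⟨(e j).2, fun h ↦ hij (e.injective (Subtype.ext h.symm))⟩, hsub _ hj⟩
  · rw [dense_iff_closure_eq, ← Set.univ_subset_iff, ← sUnion_irreducibleComponents]
    refine Set.sUnion_subset fun Z hZ ↦ ?_
    have := subset_closure_inter_of_isPreirreducible_of_isOpen hZ.1.2 (U ⟨Z, hZ⟩).isOpen
      (by rw [Set.inter_eq_right.mpr (hsub ⟨Z, hZ⟩)]; exact hUne _)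
    refine this.trans (closure_mono (Set.inter_subset_right.trans ?_))
    exact Set.subset_iUnion_of_subset (e.symm ⟨Z, hZ⟩) 
      (congrArg (fun Z ↦ (U Z : Set X)) (e.apply_symm_apply ⟨Z, hZ⟩)).ge

theorem mainTheorem8
    -- a property of schemes (invariant under isomorphism), used only on arithmetic
    -- schemes of dimension at most one
    (P : ObjectProperty Scheme.{u}) [P.IsClosedUnderIsomorphisms]
    -- a) reduction
    (h_red : ∀ X : Scheme.{u}, IsArithmeticSchemeDimLEOne X →
      (P X ↔ P (schemeReduction X)))
    -- b) finite disjoint unions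
    (h_coprod : ∀ (n : ℕ) (X : Fin n → Scheme.{u}), IsArithmeticSchemeDimLEOne (∐ X) →
      (P (∐ X) ↔ ∀ i, P (X i)))
    -- c) dense open subschemes
    (h_open : ∀ X : Scheme.{u}, IsArithmeticSchemeDimLEOne X →
      ∀ U : X.Opens, Dense (U : Set X) → (P X ↔ P U.toScheme))
    -- 0) finite fields
    (h_finite : ∀ (k : Type u) [Field k] [Finite k], P (Spec (CommRingCat.of k)))
    -- 1) smooth curves over finite fields
    (h_curve : ∀ (k : Type u) [Field k] [Finite k] (C : Scheme.{u})
      (f : C ⟶ Spec (CommRingCat.of k)), IsSmoothCurveOver f → P C)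
    -- 2) rings of integers of number fields
    (h_numberField : ∀ (F : Type u) [Field F] [NumberField F],
      P (Spec (CommRingCat.of (𝓞 F))))
    (X : Scheme.{u}) (hX : IsArithmeticScheme X) (hdim : topologicalKrullDim X = 1) :
    P X := by
  have hX₁ : IsArithmeticSchemeDimLEOne X := ⟨hX, hdim.le⟩
  rw [h_red X hX₁]
  have hR := hX₁.schemeReduction
  have := schemeReduction_isReduced X
  have := hR.isNoetherian
  obtain ⟨n, U, hUa, hUi, hUd, hU⟩ := (schemeReduction X).exists_disjoint_affineOpens
  -- Disjointness identifies the abstract coproduct with an open subscheme, so that (c) and (b) both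
  -- apply to it.
  have hopen : IsOpenImmersion (Sigma.desc fun i ↦ (U i).ι) :=
    isOpenImmersion_sigmaDesc _ _ fun i j hij ↦ by
      simpa [Function.onFun] using hUd hij
  have hcoprod := hR.of_isOpenImmersion (Sigma.desc fun i ↦ (U i).ι)
  rw [ObjectProperty.iff_of_isOpenImmersion h_open hR (Sigma.desc fun i ↦ (U i).ι), h_coprod _ _ hcoprod]
  · intro i
    have hUi := hUi i
    have : IsAffine (U i) := hUa i
    let A := Γ(U i, ⊤)
    have hA : IsArithmeticSchemeDimLEOne (Spec (.of A)) :=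
      (hR.of_isOpenImmersion (U i).ι).of_isOpenImmersion (U i).toScheme.isoSpec.inv
    obtain ⟨_, _⟩ := (isArithmeticSchemeDimLEOne_Spec_iff A).mp hA
    rw [P.prop_iff_of_iso (U i).toScheme.isoSpec]
    exact property_Spec_of_isDomain P h_open h_finite h_curve h_numberField A
  · refine hU.mono (Set.iUnion_subset fun i x hx ↦ ⟨Sigma.ι (fun i ↦ (U i).toScheme) i ⟨x, hx⟩, ?_⟩)
    exact (Scheme.Hom.comp_apply _ _ _).symm.trans
      (congrArg (fun g : (U i).toScheme ⟶ schemeReduction X ↦ g ⟨x, hx⟩)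
        (Sigma.ι_desc (fun i ↦ (U i).ι) i))
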